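/- Work with the unit squares of the integer lattice $\mathbb{Z}^2$. A ribbon tetromino consists of four squares laid out in a path which starts at its bottom left-most square and in which each step goes right (R) or up (U). Let $S=\{t_2,t_3,t_5,t_8\}$, where $t_2$, $t_3$, $t_5$, $t_8$ are the ribbon tetrominoes with step sequences RRU, RUR, URR and UUU, respectively; that is, with lower-left corners of squares as coordinates, $$t_2=\{(0,0),(1,0),(2,0),(2,1)\},\quad t_3=\{(0,0),(1,0),(1,1),(2,1)\},$$ $$t_5=\{(0,0),(0,1),(1,1),(2,1)\},\quad t_8=\{(0,0),(0,1),(0,2),(0,3)\}.$$ The set $S$ tiles a region if the region is the union of finitely many translates of tiles of $S$ (rotations and reflections are not allowed) that do not overlap. For integers $a,b>1$ let $M(a,b)$ be the rectangle with $a$ rows and $b$ columns (height $a$, width $b$) with its upper-left and its lower-right squares removed. Theorem. Let $a,b>1$ be integers. Then $S$ tiles $M(a,b)$ if and only if 1. $a\equiv 2 \pmod 4$ and $b$ is odd; or 2. $a$ is odd and $ab\equiv 2 \pmod 8$. -/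

import Mathlib

/-- A unit square of the integer lattice, named by its lower-left corner `(x, y)`
(`x` grows to the right, `y` grows upwards). -/
abbrev Cell := ℤ × ℤ

/-- The translate of a finite set of squares by the vector `v`. -/
def shiftTile (v : Cell) (t : Finset Cell) : Finset Cell := t.image (fun c => c + v)

/-- The tile set `S` tiles the region `Γ`: there is a finite collection `P` of pieces, each a
translate of a tile of `S` (no rotations or reflections), which are pairwise disjoint and whose
union is `Γ`. -/
def TilesRegion (S : Set (Finset Cell)) (Γ : Finset Cell) : Prop :=
  ∃ P : Finset (Finset Cell),
    (∀ p ∈ P, ∃ t ∈ S, ∃ v : Cell, p = shiftTile v t) ∧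
    (P : Set (Finset Cell)).PairwiseDisjoint id ∧
    P.biUnion id = Γ

/-- The ribbon tetromino with steps right, right, up. -/
def tile2 : Finset Cell := {(0, 0), (1, 0), (2, 0), (2, 1)}

/-- The ribbon tetromino with steps right, up, right. -/
def tile3 : Finset Cell := {(0, 0), (1, 0), (1, 1), (2, 1)}

/-- The ribbon tetromino with steps up, right, right. -/
def tile5 : Finset Cell := {(0, 0), (0, 1), (1, 1), (2, 1)}

/-- The ribbon tetromino with steps up, up, up: the vertical bar. -/
def tile8 : Finset Cell := {(0, 0), (0, 1), (0, 2), (0, 3)}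

/-- The set of tetrominoes `S = {t₂, t₃, t₅, t₈}`. -/
def tileSetS : Set (Finset Cell) := {tile2, tile3, tile5, tile8}

/-- The modified rectangle `M(a,b)`: the rectangle with `a` rows and `b` columns, without its
upper-left square `(0, a - 1)` and its lower-right square `(b - 1, 0)`. -/
noncomputable def modifiedRectangle (a b : ℕ) : Finset Cell :=
  (Finset.Ico (0 : ℤ) (b : ℤ) ×ˢ Finset.Ico (0 : ℤ) (a : ℤ)) \
    {((0 : ℤ), (a : ℤ) - 1), ((b : ℤ) - 1, (0 : ℤ))}

/-! Sufficiency is a construction: from 2×3, 3×6 and 5×2, vertical bars add four rows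
(`tiles_add_rows`) and small blocks add two or eight columns (`tiles_add_columns`).

For necessity, area gives ab ≡ 2 mod 4. What remains is that for a odd and b = 4m + 2 the number of
tiles is even (`eight_dvd_card`). The tiles of S are the ribbons with an odd number of up-steps, so
the heights of the squares of a tile have odd sum exactly when its middle step goes right
(`exists_ribbon`). Summing over M(a,b), evenly many tiles have middle step right.

Ribbons do not cross, and each diagonal meets the region in an interval, so the column of a square
counts the ribbons to its left on its diagonal. This gives the same parity in terms of the start
diagonals and the boundary (`ribbon_parity`). The boundary forces how many ribbons start on each
diagonal: as many as if each up-step of the upper left path travelled in jumps of 4 to an up-step of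
the lower right path (`ribbon_start_count_sub`, `upStep_start_count_sub`). The parity is then the
number of tiles plus a count of pairs, which is even by `even_upStep_pairs`. -/

/-! ### Translates and unions of tilings -/

theorem mem_shiftTile {v c : Cell} {t : Finset Cell} :
    c ∈ shiftTile v t ↔ (c.1 - v.1, c.2 - v.2) ∈ t := by
  simp only [shiftTile, Finset.mem_image]
  constructor
  · rintro ⟨d, hd, rfl⟩
    simpa using hd
  · intro h
    exact ⟨_, h, by ext <;> simp⟩

theorem shiftTile_shiftTile (u v : Cell) (t : Finset Cell) :
    shiftTile u (shiftTile v t) = shiftTile (v + u) t := by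
  ext c
  simp only [mem_shiftTile, Prod.fst_add, Prod.snd_add, sub_sub, add_comm]

theorem TilesRegion.empty (S : Set (Finset Cell)) : TilesRegion S ∅ :=
  ⟨∅, by simp⟩

theorem TilesRegion.of_mem {S : Set (Finset Cell)} {t : Finset Cell} (ht : t ∈ S) (v : Cell) :
    TilesRegion S (shiftTile v t) :=
  ⟨{shiftTile v t}, fun p hp => ⟨t, ht, v, Finset.mem_singleton.1 hp⟩, by simp, by simp⟩

theorem TilesRegion.union {S : Set (Finset Cell)} {Γ Δ : Finset Cell} (hΓ : TilesRegion S Γ)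
    (hΔ : TilesRegion S Δ) (hd : Disjoint Γ Δ) : TilesRegion S (Γ ∪ Δ) := by
  obtain ⟨P, hP, hPd, rfl⟩ := hΓ
  obtain ⟨Q, hQ, hQd, rfl⟩ := hΔ
  refine ⟨P ∪ Q, ?_, ?_, ?_⟩
  · intro p hp
    rcases Finset.mem_union.1 hp with h | h
    exacts [hP p h, hQ p h]
  · rw [Finset.coe_union, Set.pairwiseDisjoint_union]
    exact ⟨hPd, hQd, fun p hp q hq _ => hd.mono
      (Finset.subset_biUnion_of_mem id hp) (Finset.subset_biUnion_of_mem id hq)⟩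
  · exact Finset.union_biUnion

theorem TilesRegion.shift {S : Set (Finset Cell)} {Γ : Finset Cell} (hΓ : TilesRegion S Γ)
    (u : Cell) : TilesRegion S (shiftTile u Γ) := by
  obtain ⟨P, hP, hPd, rfl⟩ := hΓ
  refine ⟨P.image (shiftTile u), ?_, ?_, ?_⟩
  · simp only [Finset.mem_image]
    rintro _ ⟨p, hp, rfl⟩
    obtain ⟨t, ht, v, rfl⟩ := hP p hp
    exact ⟨t, ht, v + u, shiftTile_shiftTile u v t⟩
  · rw [Finset.coe_image]
    rintro _ ⟨p, hp, rfl⟩ _ ⟨q, hq, rfl⟩ hpq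
    have h := hPd hp hq (fun h => hpq (by rw [h]))
    simp only [Function.onFun, id, Finset.disjoint_left, mem_shiftTile] at h ⊢
    exact fun c hc => h hc
  · ext c
    simp only [Finset.mem_biUnion, Finset.mem_image, id, mem_shiftTile]
    constructor
    · rintro ⟨_, ⟨p, hp, rfl⟩, hc⟩
      exact ⟨p, hp, mem_shiftTile.1 hc⟩
    · rintro ⟨p, hp, hc⟩
      exact ⟨_, ⟨p, hp, rfl⟩, mem_shiftTile.2 hc⟩

/-- A list of pairwise disjoint translates of tiles tiles its union. -/
theorem TilesRegion.of_list {S : Set (Finset Cell)} :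
    ∀ l : List (Cell × Finset Cell), (∀ p ∈ l, p.2 ∈ S) →
      l.Pairwise (fun p q => Disjoint (shiftTile p.1 p.2) (shiftTile q.1 q.2)) →
      TilesRegion S (l.foldr (fun p Γ => shiftTile p.1 p.2 ∪ Γ) ∅)
  | [], _, _ => TilesRegion.empty S
  | p :: l, hS, hd => by
    rw [List.pairwise_cons] at hd
    refine (TilesRegion.of_mem (hS p (by simp)) p.1).union
      (TilesRegion.of_list l (fun q hq => hS q (by simp [hq])) hd.2) ?_
    have key : ∀ l' : List (Cell × Finset Cell),
        (∀ q ∈ l', Disjoint (shiftTile p.1 p.2) (shiftTile q.1 q.2)) →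
        Disjoint (shiftTile p.1 p.2) (l'.foldr (fun p Γ => shiftTile p.1 p.2 ∪ Γ) ∅) := by
      intro l'
      induction l' with
      | nil => simp
      | cons q l' ih =>
        intro h
        exact Finset.disjoint_union_right.2
          ⟨h q (by simp), ih fun r hr => h r (by simp [hr])⟩
    exact key l hd.1

/-! ### Constructions -/

theorem tile2_mem : tile2 ∈ tileSetS := by simp [tileSetS]
theorem tile3_mem : tile3 ∈ tileSetS := by simp [tileSetS]
theorem tile5_mem : tile5 ∈ tileSetS := by simp [tileSetS]
theorem tile8_mem : tile8 ∈ tileSetS := by simp [tileSetS]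

theorem mem_modifiedRectangle {a b : ℕ} {x y : ℤ} : (x, y) ∈ modifiedRectangle a b ↔
    (0 ≤ x ∧ x < b ∧ 0 ≤ y ∧ y < a) ∧ ¬(x = 0 ∧ y = a - 1) ∧ ¬(x = b - 1 ∧ y = 0) := by
  simp only [modifiedRectangle, Finset.mem_sdiff, Finset.mem_product, Finset.mem_Ico,
    Finset.mem_insert, Finset.mem_singleton, Prod.mk.injEq]
  tauto

/-- Vertical bars standing on the `b` columns `0, …, b - 1`; the first one starts at height
`h - 1`, the others at height `h`. -/
theorem tiles_bars (h : ℤ) (b : ℕ) : TilesRegion tileSetS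
    ((Finset.Ico (0 : ℤ) b ×ˢ Finset.Ico (h - 1) (h + 4)).filter
      (fun c => if c.1 = 0 then c.2 < h + 3 else h ≤ c.2)) := by
  induction b with
  | zero => simpa using TilesRegion.empty tileSetS
  | succ n ih =>
    convert ih.union (TilesRegion.of_mem tile8_mem ((n : ℤ), if n = 0 then h - 1 else h)) ?_
      using 1
    · ext ⟨x, y⟩
      simp only [Finset.mem_filter, Finset.mem_product, Finset.mem_Ico, Finset.mem_union,
        mem_shiftTile, tile8, Finset.mem_insert, Finset.mem_singleton, Prod.mk.injEq]
      split_ifs <;> omega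
    · rw [Finset.disjoint_left]
      rintro ⟨x, y⟩
      simp only [Finset.mem_filter, Finset.mem_product, Finset.mem_Ico,
        mem_shiftTile, tile8, Finset.mem_insert, Finset.mem_singleton, Prod.mk.injEq]
      split_ifs <;> omega

/-- The lowered first bar fills the old missing corner and leaves the new one empty. -/
theorem tiles_add_rows {a b : ℕ} (ha : 0 < a) (hb : 1 < b)
    (h : TilesRegion tileSetS (modifiedRectangle a b)) :
    TilesRegion tileSetS (modifiedRectangle (a + 4) b) := by
  convert h.union (tiles_bars a b) ?_ using 1
  · ext ⟨x, y⟩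
    simp only [Finset.mem_union, mem_modifiedRectangle, Finset.mem_filter, Finset.mem_product,
      Finset.mem_Ico]
    split_ifs <;> push_cast <;> omega
  · rw [Finset.disjoint_left]
    rintro ⟨x, y⟩
    simp only [mem_modifiedRectangle, Finset.mem_filter, Finset.mem_product, Finset.mem_Ico]
    split_ifs <;> omega

/-- The region by which `M(a, b + k)` exceeds the translate of `M(a, b)`. -/
noncomputable def columnBlock (a k : ℕ) : Finset Cell :=
  insert (-1, 0) (Finset.Ico (0 : ℤ) k ×ˢ Finset.Ico (0 : ℤ) a) \ {((k : ℤ) - 1, 0)}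

theorem tiles_add_columns {a b k : ℕ} (ha : 1 < a) (hb : 1 < b) (hk : 0 < k)
    (h : TilesRegion tileSetS (modifiedRectangle a b))
    (hc : TilesRegion tileSetS (columnBlock a k)) :
    TilesRegion tileSetS (modifiedRectangle a (b + k)) := by
  convert h.union (hc.shift ((b : ℤ), 0)) ?_ using 1
  · ext ⟨x, y⟩
    simp only [Finset.mem_union, mem_modifiedRectangle, mem_shiftTile, columnBlock,
      Finset.mem_sdiff, Finset.mem_insert, Finset.mem_product, Finset.mem_Ico,
      Finset.mem_singleton, Prod.mk.injEq]
    push_cast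
    omega
  · rw [Finset.disjoint_left]
    rintro ⟨x, y⟩
    simp only [mem_modifiedRectangle, mem_shiftTile, columnBlock,
      Finset.mem_sdiff, Finset.mem_insert, Finset.mem_product, Finset.mem_Ico,
      Finset.mem_singleton, Prod.mk.injEq]
    omega

theorem tiles_columnBlock_two : TilesRegion tileSetS (columnBlock 2 2) := by
  convert TilesRegion.of_list (S := tileSetS) [((-1, 0), tile3)] ?_ ?_ using 1
  · decide +kernel
  · simp [tile3_mem]
  · decide +kernel

theorem tiles_columnBlock_three : TilesRegion tileSetS (columnBlock 3 8) := by
  convert TilesRegion.of_list (S := tileSetS) [((-1, 0), tile2), ((0, 1), tile5), ((2, 0), tile2),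
    ((2, 1), tile3), ((5, 0), tile3), ((5, 1), tile5)] ?_ ?_ using 1
  · decide +kernel
  · simp [tile2_mem, tile3_mem, tile5_mem]
  · decide +kernel

theorem tiles_columnBlock_five : TilesRegion tileSetS (columnBlock 5 8) := by
  convert TilesRegion.of_list (S := tileSetS) [((-1, 0), tile2), ((0, 1), tile5), ((0, 3), tile5),
    ((1, 3), tile2), ((2, 0), tile2), ((2, 1), tile3), ((4, 3), tile5), ((5, 0), tile3),
    ((5, 1), tile5), ((5, 3), tile2)] ?_ ?_ using 1
  · decide +kernel
  · simp [tile2_mem, tile3_mem, tile5_mem]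
  · decide +kernel

theorem tiles_two_three : TilesRegion tileSetS (modifiedRectangle 2 3) := by
  convert TilesRegion.of_list (S := tileSetS) [((0, 0), tile3)] ?_ ?_ using 1
  · unfold modifiedRectangle; decide +kernel
  · simp [tile3_mem]
  · decide +kernel

theorem tiles_three_six : TilesRegion tileSetS (modifiedRectangle 3 6) := by
  convert TilesRegion.of_list (S := tileSetS) [((0, 0), tile2), ((0, 1), tile3), ((3, 0), tile3),
    ((3, 1), tile5)] ?_ ?_ using 1
  · unfold modifiedRectangle; decide +kernel
  · simp [tile2_mem, tile3_mem, tile5_mem]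
  · decide +kernel

theorem tiles_five_two : TilesRegion tileSetS (modifiedRectangle 5 2) := by
  convert TilesRegion.of_list (S := tileSetS) [((0, 0), tile8), ((1, 1), tile8)] ?_ ?_ using 1
  · unfold modifiedRectangle; decide +kernel
  · simp [tile8_mem]
  · decide +kernel

theorem tiles_two (n : ℕ) : TilesRegion tileSetS (modifiedRectangle 2 (3 + 2 * n)) := by
  induction n with
  | zero => exact tiles_two_three
  | succ n ih =>
    rw [mul_add_one, ← add_assoc]
    exact tiles_add_columns (by omega) (by omega) (by omega) ih tiles_columnBlock_two

theorem tiles_three (n : ℕ) : TilesRegion tileSetS (modifiedRectangle 3 (6 + 8 * n)) := by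
  induction n with
  | zero => exact tiles_three_six
  | succ n ih =>
    rw [mul_add_one, ← add_assoc]
    exact tiles_add_columns (by omega) (by omega) (by omega) ih tiles_columnBlock_three

theorem tiles_five (n : ℕ) : TilesRegion tileSetS (modifiedRectangle 5 (2 + 8 * n)) := by
  induction n with
  | zero => exact tiles_five_two
  | succ n ih =>
    rw [mul_add_one, ← add_assoc]
    exact tiles_add_columns (by omega) (by omega) (by omega) ih tiles_columnBlock_five

theorem tiles_add_four_mul_rows {a b : ℕ} (ha : 0 < a) (hb : 1 < b)
    (h : TilesRegion tileSetS (modifiedRectangle a b)) (n : ℕ) :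
    TilesRegion tileSetS (modifiedRectangle (a + 4 * n) b) := by
  induction n with
  | zero => exact h
  | succ n ih =>
    rw [mul_add_one, ← add_assoc]
    exact tiles_add_rows (by omega) hb ih

theorem tiles_of_congruence {a b : ℕ} (ha : 1 < a) (hb : 1 < b)
    (h : (a ≡ 2 [MOD 4] ∧ Odd b) ∨ (Odd a ∧ a * b ≡ 2 [MOD 8])) :
    TilesRegion tileSetS (modifiedRectangle a b) := by
  rcases h with ⟨h1, h2⟩ | ⟨h1, h2⟩
  · rw [Nat.odd_iff] at h2
    unfold Nat.ModEq at h1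
    obtain ⟨i, rfl⟩ : ∃ i, a = 2 + 4 * i := ⟨a / 4, by omega⟩
    obtain ⟨j, rfl⟩ : ∃ j, b = 3 + 2 * j := ⟨(b - 3) / 2, by omega⟩
    exact tiles_add_four_mul_rows (by omega) (by omega) (tiles_two j) i
  · rw [Nat.odd_iff] at h1
    unfold Nat.ModEq at h2
    -- Writing b = 2c, the congruence says ac ≡ 1 mod 4, that is c ≡ a mod 4.
    have hab : (a % 4 = 1 ∧ b % 8 = 2) ∨ (a % 4 = 3 ∧ b % 8 = 6) := by
      rw [Nat.mul_mod] at h2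
      have h3 : a % 4 = a % 8 % 4 := by omega
      have h4 : a % 8 % 2 = 1 := by omega
      have h5 : a % 8 < 8 := Nat.mod_lt _ (by norm_num)
      have h6 : b % 8 < 8 := Nat.mod_lt _ (by norm_num)
      rw [h3]
      generalize a % 8 = r at *
      generalize b % 8 = t at *
      interval_cases r <;> interval_cases t <;> simp_all
    rcases hab with ⟨h3, h4⟩ | ⟨h3, h4⟩
    · obtain ⟨i, rfl⟩ : ∃ i, a = 5 + 4 * i := ⟨(a - 5) / 4, by omega⟩
      obtain ⟨j, rfl⟩ : ∃ j, b = 2 + 8 * j := ⟨b / 8, by omega⟩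
      exact tiles_add_four_mul_rows (by omega) (by omega) (tiles_five j) i
    · obtain ⟨i, rfl⟩ : ∃ i, a = 3 + 4 * i := ⟨a / 4, by omega⟩
      obtain ⟨j, rfl⟩ : ∃ j, b = 6 + 8 * j := ⟨b / 8, by omega⟩
      exact tiles_add_four_mul_rows (by omega) (by omega) (tiles_three j) i

/-! ### Non-crossing ribbons and the parity of middle steps -/

/-- Disjoint ribbons do not cross. The ribbon `p` occupies the diagonals
`x + y = s p, …, s p + 3`, on the diagonal `k` in the column `X p k`. -/
theorem ribbon_lt_iff_lt_succ {ι : Type*} {P : Finset ι} {s : ι → ℤ} {X : ι → ℤ → ℤ}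
    (hX : ∀ p ∈ P, ∀ k, X p k ≤ X p (k + 1) ∧ X p (k + 1) ≤ X p k + 1)
    (hinj : ∀ k, Set.InjOn (X · k) (P.filter fun p => s p ≤ k ∧ k < s p + 4))
    {p q : ι} (hp : p ∈ P) (hq : q ∈ P) {k : ℤ} (hp1 : s p ≤ k) (hp2 : k + 1 < s p + 4)
    (hq1 : s q ≤ k) (hq2 : k + 1 < s q + 4) : X p k < X q k ↔ X p (k + 1) < X q (k + 1) := by
  by_cases hpq : p = q
  · subst hpq; simp
  have h1 : X p k ≠ X q k := fun h => hpq (hinj k (by simp [hp]; omega) (by simp [hq]; omega) h)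
  have h2 : X p (k + 1) ≠ X q (k + 1) :=
    fun h => hpq (hinj (k + 1) (by simp [hp]; omega) (by simp [hq]; omega) h)
  have := hX p hp k
  have := hX q hq k
  omega

/-- The number of ribbons whose middle step goes right, modulo `2`, in terms of the leftmost columns
`f k` of the region on its diagonals and of the diagonals `s p` on which the ribbons start. -/
theorem ribbon_parity {ι : Type*} (P : Finset ι) (s : ι → ℤ) (X : ι → ℤ → ℤ) (f : ℤ → ℤ)
    (hX : ∀ p ∈ P, ∀ k, X p k ≤ X p (k + 1) ∧ X p (k + 1) ≤ X p k + 1)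
    (hinj : ∀ k, Set.InjOn (X · k) (P.filter fun p => s p ≤ k ∧ k < s p + 4))
    (hpos : ∀ q ∈ P, ∀ k, s q ≤ k → k < s q + 4 →
      X q k - f k = ∑ p ∈ P, if s p ≤ k ∧ k < s p + 4 ∧ X p k < X q k then 1 else 0) :
    ∑ q ∈ P, (X q (s q + 2) - X q (s q + 1)) ≡
      ∑ q ∈ P, (f (s q + 2) - f (s q + 1)) +
        ∑ q ∈ P, ∑ p ∈ P, (if s p = s q + 2 then 1 else 0) [ZMOD 2] := by
  have hcross := fun {p q} => ribbon_lt_iff_lt_succ hX hinj (p := p) (q := q)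
  -- Ribbons present on both diagonals stay on their side of `q`; only those starting on `s q + 2`
  -- or ending on `s q + 1` change the count to its left.
  have h1 : ∀ q ∈ P, X q (s q + 2) - X q (s q + 1) = (f (s q + 2) - f (s q + 1)) +
      ∑ p ∈ P, (if s p = s q + 2 ∧ X p (s q + 2) < X q (s q + 2) then (1 : ℤ) else 0) -
      ∑ p ∈ P, (if s q = s p + 2 ∧ X p (s q + 1) < X q (s q + 1) then (1 : ℤ) else 0) := by
    intro q hq
    have e1 := hpos q hq (s q + 1) (by omega) (by omega)
    have e2 := hpos q hq (s q + 2) (by omega) (by omega)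
    have e3 : ∑ p ∈ P, (if s p ≤ s q + 2 ∧ s q + 2 < s p + 4 ∧ X p (s q + 2) < X q (s q + 2)
          then (1 : ℤ) else 0) +
        ∑ p ∈ P, (if s q = s p + 2 ∧ X p (s q + 1) < X q (s q + 1) then (1 : ℤ) else 0) =
        ∑ p ∈ P, (if s p ≤ s q + 1 ∧ s q + 1 < s p + 4 ∧ X p (s q + 1) < X q (s q + 1)
          then (1 : ℤ) else 0) +
        ∑ p ∈ P, (if s p = s q + 2 ∧ X p (s q + 2) < X q (s q + 2) then (1 : ℤ) else 0) := by
      rw [← Finset.sum_add_distrib, ← Finset.sum_add_distrib]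
      refine Finset.sum_congr rfl fun p hp => ?_
      by_cases hs : s q - 1 ≤ s p ∧ s p ≤ s q + 1
      · have := hcross hp hq (k := s q + 1) (by omega) (by omega) (by omega) (by omega)
        rw [show s q + 1 + 1 = s q + 2 by ring] at this
        simp only [this]
        split_ifs <;> omega
      · split_ifs <;> omega
    linarith
  -- In a pair of ribbons with starts 2 apart exactly one is to the left, so the pair enters exactly
  -- one of the two sums; signs do not matter mod 2.
  have h2 : ∑ q ∈ P, ∑ p ∈ P, (if s p = s q + 2 then (1 : ℤ) else 0) =
      ∑ q ∈ P, ∑ p ∈ P,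
        (if s p = s q + 2 ∧ X p (s q + 2) < X q (s q + 2) then (1 : ℤ) else 0) +
      ∑ q ∈ P, ∑ p ∈ P,
        (if s q = s p + 2 ∧ X p (s q + 1) < X q (s q + 1) then (1 : ℤ) else 0) := by
    conv_rhs => rw [add_comm, Finset.sum_comm, add_comm]
    simp only [← Finset.sum_add_distrib]
    refine Finset.sum_congr rfl fun q hq => Finset.sum_congr rfl fun p hp => ?_
    by_cases hs : s p = s q + 2
    · have hc := hcross hp hq (k := s q + 2) (by omega) (by omega) (by omega) (by omega)
      have hne : X p (s q + 2) ≠ X q (s q + 2) := by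
        intro h
        have := hinj (s q + 2) (by simp [hp]; omega) (by simp [hq]) h
        subst this
        omega
      have hne' : X p (s q + 2 + 1) ≠ X q (s q + 2 + 1) := by
        intro h
        have := hinj (s q + 2 + 1) (by simp [hp]; omega)
          (by simp [hq]; omega) h
        subst this
        omega
      rw [hs]
      split_ifs <;> omega
    · split_ifs <;> omega
  rw [Finset.sum_congr rfl h1, h2, Finset.sum_sub_distrib, Finset.sum_add_distrib]
  exact (Int.modEq_iff_dvd.2 ⟨∑ q ∈ P, ∑ p ∈ P,
    (if s q = s p + 2 ∧ X p (s q + 1) < X q (s q + 1) then (1 : ℤ) else 0), by ring⟩)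

/-! ### Parity of pairs of arithmetic progressions -/

theorem sum_range_ite_eq (n : ℕ) (v : ℤ) (g : ℕ → ℤ) (hg : ∀ i, g i = g 0 + 4 * i) :
    (∑ i ∈ Finset.range n, if g i = v then (1 : ℤ) else 0) =
      if g 0 ≤ v ∧ v < g 0 + 4 * n ∧ (v - g 0) % 4 = 0 then 1 else 0 := by
  induction n with
  | zero => simp; omega
  | succ n ih =>
    rw [Finset.sum_range_succ, ih]
    have := hg n
    push_cast
    split_ifs <;> omega

/-- The number of pairs `i, j < e` with `x + 4 i + 2 = y + 4 j`, plus the number of `i < e` with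
`x + 4 i + 2 = y`. -/
def stepPairs (e : ℕ) (x y : ℤ) : ℤ :=
  ∑ i ∈ Finset.range e, ((if y = x + 4 * i + 2 then 1 else 0) +
    ∑ j ∈ Finset.range e, if y + 4 * j = x + 4 * i + 2 then 1 else 0)

theorem stepPairs_succ (e : ℕ) (x y : ℤ) : stepPairs (e + 1) x y = stepPairs e x y +
    (∑ i ∈ Finset.range e, if y + 4 * e = x + 4 * i + 2 then 1 else 0) +
    (if y = x + 4 * e + 2 then 1 else 0) +
    ∑ j ∈ Finset.range (e + 1), if y + 4 * j = x + 4 * e + 2 then 1 else 0 := by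
  unfold stepPairs
  rw [Finset.sum_range_succ]
  simp only [Finset.sum_range_succ _ e, Finset.sum_add_distrib]
  ring

/-- Up to symmetry, only y = x + 4d + 2 with 0 ≤ d < e contributes. The two orders then have e - d
and e - d - 1 pairs, and the extra term of `stepPairs` adds 1, for a total of 2(e - d). -/
theorem even_stepPairs_add_swap (e : ℕ) (x y : ℤ) :
    Even (stepPairs e x y + stepPairs e y x) := by
  induction e with
  | zero => simp [stepPairs]
  | succ e ih =>
    rw [stepPairs_succ, stepPairs_succ]
    have h1 : ∀ x y : ℤ, (∑ i ∈ Finset.range e, if y + 4 * e = x + 4 * i + 2 then (1 : ℤ) else 0) =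
        if x + 2 ≤ y + 4 * e ∧ y < x + 2 ∧ (y - (x + 2)) % 4 = 0 then 1 else 0 := by
      intro x y
      have := sum_range_ite_eq e (y + 4 * e) (fun i => x + 4 * i + 2) (by intro i; push_cast; ring)
      simp only [eq_comm (a := y + 4 * (e : ℤ))]
      rw [this]
      push_cast
      split_ifs <;> omega
    have h2 : ∀ x y : ℤ, (∑ j ∈ Finset.range (e + 1),
        if y + 4 * j = x + 4 * e + 2 then (1 : ℤ) else 0) =
        if y ≤ x + 4 * e + 2 ∧ x < y + 2 ∧ (x + 2 - y) % 4 = 0 then 1 else 0 := by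
      intro x y
      have := sum_range_ite_eq (e + 1) (x + 4 * e + 2) (fun i => y + 4 * i)
        (by intro i; push_cast; ring)
      rw [this]
      push_cast
      split_ifs <;> omega
    rw [h1, h1, h2, h2]
    rw [Int.even_iff] at ih ⊢
    split_ifs <;> omega

theorem stepPairs_self (e : ℕ) (x : ℤ) : stepPairs e x x = 0 := by
  refine Finset.sum_eq_zero fun i _ => ?_
  rw [if_neg (by omega), Finset.sum_eq_zero fun j _ => if_neg (by omega), add_zero]

theorem even_sum_of_even_add_swap (A : Finset ℤ) (F : ℤ → ℤ → ℤ)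
    (h : ∀ x y, Even (F x y + F y x)) (h0 : ∀ x, F x x = 0) :
    Even (∑ x ∈ A, ∑ y ∈ A, F x y) := by
  have key : ∀ z : ℤ, Even z ↔ (z : ZMod 2) = 0 := fun z => by
    rw [even_iff_two_dvd]
    exact_mod_cast (ZMod.intCast_zmod_eq_zero_iff_dvd z 2).symm
  rw [← Finset.sum_product', key]
  push_cast
  refine Finset.sum_involution (fun p _ => p.swap) ?_ ?_ ?_ ?_
  · intro p _
    have := h p.1 p.2
    rw [key] at this
    simpa using this
  · rintro ⟨x, y⟩ _ hne heq
    have : y = x := congrArg Prod.fst heq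
    subst this
    simp [h0] at hne
  · rintro ⟨x, y⟩ hxy
    simp only [Finset.mem_product, Prod.swap] at hxy ⊢
    exact hxy.symm
  · simp

/-- Sums over two families with the same number of indices over each value agree. -/
theorem sum_comp_eq_of_card_fiber_eq {ι κ : Type*} (P : Finset ι) (J : Finset κ) (s : ι → ℤ)
    (σ : κ → ℤ)
    (h : ∀ k, (P.filter fun p => s p = k).card = (J.filter fun j => σ j = k).card)
    (F : ℤ → ℤ) : ∑ p ∈ P, F (s p) = ∑ j ∈ J, F (σ j) := by
  have hm : P.val.map s = J.val.map σ := by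
    ext k
    rw [Multiset.count_map, Multiset.count_map]
    simpa [Finset.card_def, eq_comm] using h k
  have := congrArg (fun m => (m.map F).sum) hm
  simpa using this

/-! ### Tiles as ribbons -/

theorem card_shiftTile (v : Cell) (t : Finset Cell) : (shiftTile v t).card = t.card :=
  Finset.card_image_of_injective _ (add_left_injective v)

theorem sum_snd_shiftTile (v : Cell) (t : Finset Cell) :
    ∑ c ∈ shiftTile v t, c.2 = ∑ c ∈ t, c.2 + t.card * v.2 := by
  rw [shiftTile, Finset.sum_image fun _ _ _ _ h => add_left_injective v h]
  simp [Finset.sum_add_distrib]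

/-- A translate of a tile of `S` as a ribbon: it meets the diagonals `s, …, s + 3`, and its square
on the diagonal `k` lies in the column `X k`. -/
theorem exists_ribbon {t : Finset Cell} (ht : t ∈ tileSetS) (v : Cell) :
    ∃ (s : ℤ) (X : ℤ → ℤ), (∀ k, X k ≤ X (k + 1) ∧ X (k + 1) ≤ X k + 1) ∧
      (∀ c, c ∈ shiftTile v t ↔ s ≤ c.1 + c.2 ∧ c.1 + c.2 < s + 4 ∧ X (c.1 + c.2) = c.1) ∧
      ∑ c ∈ shiftTile v t, c.2 ≡ X (s + 2) - X (s + 1) [ZMOD 2] ∧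
      (shiftTile v t).card = 4 := by
  rw [sum_snd_shiftTile, card_shiftTile]
  simp only [tileSetS, Set.mem_insert_iff, Set.mem_singleton_iff] at ht
  rcases ht with rfl | rfl | rfl | rfl
  -- Clamping makes the column constant beyond the ribbon, so the step bounds hold for every `k`.
  · refine ⟨v.1 + v.2, fun k => v.1 + max 0 (min 2 (k - (v.1 + v.2))), ?_, ?_, ?_, rfl⟩
    · intro k; dsimp only; omega
    · intro c
      simp only [mem_shiftTile, tile2, Finset.mem_insert, Finset.mem_singleton, Prod.mk.injEq]
      omega
    · rw [show ∑ c ∈ tile2, c.2 = 1 from rfl, show tile2.card = 4 from rfl, Int.ModEq]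
      dsimp only
      omega
  · refine ⟨v.1 + v.2, fun k => v.1 + max 0 (min 1 (k - (v.1 + v.2))) +
      max 0 (min 1 (k - (v.1 + v.2) - 2)), ?_, ?_, ?_, rfl⟩
    · intro k; dsimp only; omega
    · intro c
      simp only [mem_shiftTile, tile3, Finset.mem_insert, Finset.mem_singleton, Prod.mk.injEq]
      omega
    · rw [show ∑ c ∈ tile3, c.2 = 2 from rfl, show tile3.card = 4 from rfl, Int.ModEq]
      dsimp only
      omega
  · refine ⟨v.1 + v.2, fun k => v.1 + max 0 (min 2 (k - (v.1 + v.2) - 1)), ?_, ?_, ?_, rfl⟩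
    · intro k; dsimp only; omega
    · intro c
      simp only [mem_shiftTile, tile5, Finset.mem_insert, Finset.mem_singleton, Prod.mk.injEq]
      omega
    · rw [show ∑ c ∈ tile5, c.2 = 3 from rfl, show tile5.card = 4 from rfl, Int.ModEq]
      dsimp only
      omega
  · refine ⟨v.1 + v.2, fun k => v.1, ?_, ?_, ?_, rfl⟩
    · intro k; dsimp only; omega
    · intro c
      simp only [mem_shiftTile, tile8, Finset.mem_insert, Finset.mem_singleton, Prod.mk.injEq]
      omega
    · rw [show ∑ c ∈ tile8, c.2 = 6 from rfl, show tile8.card = 4 from rfl, Int.ModEq]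
      dsimp only
      omega

theorem TilesRegion.exists_ribbons {Γ : Finset Cell} (h : TilesRegion tileSetS Γ) :
    ∃ (P : Finset (Finset Cell)) (s : Finset Cell → ℤ) (X : Finset Cell → ℤ → ℤ),
      (∀ p ∈ P, ∀ k, X p k ≤ X p (k + 1) ∧ X p (k + 1) ≤ X p k + 1) ∧
      (∀ k, Set.InjOn (X · k) (P.filter fun p => s p ≤ k ∧ k < s p + 4)) ∧
      (∀ x y, (x, y) ∈ Γ ↔ ∃ p ∈ P, s p ≤ x + y ∧ x + y < s p + 4 ∧ X p (x + y) = x) ∧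
      Γ.card = 4 * P.card ∧
      ∑ c ∈ Γ, c.2 ≡ ∑ p ∈ P, (X p (s p + 2) - X p (s p + 1)) [ZMOD 2] := by
  obtain ⟨P, hP, hd, rfl⟩ := h
  have hex : ∀ p ∈ P, ∃ (s : ℤ) (X : ℤ → ℤ), (∀ k, X k ≤ X (k + 1) ∧ X (k + 1) ≤ X k + 1) ∧
      (∀ c, c ∈ p ↔ s ≤ c.1 + c.2 ∧ c.1 + c.2 < s + 4 ∧ X (c.1 + c.2) = c.1) ∧
      ∑ c ∈ p, c.2 ≡ X (s + 2) - X (s + 1) [ZMOD 2] ∧ p.card = 4 := by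
    intro p hp
    obtain ⟨t, ht, v, rfl⟩ := hP p hp
    exact exists_ribbon ht v
  choose! s X hX hmem hsum hcard using hex
  refine ⟨P, s, X, hX, ?_, ?_, ?_, ?_⟩
  · intro k p hp q hq hpq
    simp only [Finset.coe_filter, Set.mem_ofPred_eq] at hp hq hpq
    by_contra hne
    have hdis := hd hp.1 hq.1 hne
    exact Finset.disjoint_left.1 hdis ((hmem p hp.1 (X p k, k - X p k)).2 (by simpa using hp.2))
      ((hmem q hq.1 (X p k, k - X p k)).2 (by simpa [hpq] using hq.2))
  · intro x y
    simp only [Finset.mem_biUnion, id]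
    exact exists_congr fun p => and_congr_right fun hp => hmem p hp (x, y)
  · rw [Finset.card_biUnion hd, mul_comm]
    exact Finset.sum_const_nat hcard
  · rw [Finset.sum_biUnion hd]
    exact Int.ModEq.sum fun p hp => hsum p hp

/-! ### Area, heights and boundary paths of the modified rectangle -/

theorem card_modifiedRectangle {a b : ℕ} (ha : 1 < a) (hb : 1 < b) :
    (modifiedRectangle a b).card + 2 = a * b := by
  have hsub : {((0 : ℤ), (a : ℤ) - 1), ((b : ℤ) - 1, (0 : ℤ))} ⊆
      Finset.Ico (0 : ℤ) (b : ℤ) ×ˢ Finset.Ico (0 : ℤ) (a : ℤ) := by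
    intro c
    simp only [Finset.mem_insert, Finset.mem_singleton, Finset.mem_product, Finset.mem_Ico]
    rintro (rfl | rfl) <;> simp <;> omega
  have h2 : ({((0 : ℤ), (a : ℤ) - 1), ((b : ℤ) - 1, (0 : ℤ))} : Finset Cell).card = 2 := by
    refine Finset.card_pair ?_
    simp only [ne_eq, Prod.mk.injEq]
    omega
  have := Finset.card_sdiff_add_card_eq_card hsub
  rw [h2] at this
  rw [modifiedRectangle, this]
  simp [mul_comm]

theorem even_sum_snd_modifiedRectangle {a b : ℕ} (ha : 1 < a) (hb : 1 < b) (ha' : Odd a)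
    (hb' : Even b) : ∑ c ∈ modifiedRectangle a b, c.2 ≡ 0 [ZMOD 2] := by
  have hsub : {((0 : ℤ), (a : ℤ) - 1), ((b : ℤ) - 1, (0 : ℤ))} ⊆
      Finset.Ico (0 : ℤ) (b : ℤ) ×ˢ Finset.Ico (0 : ℤ) (a : ℤ) := by
    intro c
    simp only [Finset.mem_insert, Finset.mem_singleton, Finset.mem_product, Finset.mem_Ico]
    rintro (rfl | rfl) <;> simp <;> omega
  have h2 : ∑ c ∈ ({((0 : ℤ), (a : ℤ) - 1), ((b : ℤ) - 1, (0 : ℤ))} : Finset Cell), c.2 =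
      a - 1 := by
    rw [Finset.sum_pair]
    · simp
    · simp only [ne_eq, Prod.mk.injEq]
      omega
  have := Finset.sum_sdiff (f := fun c : Cell => c.2) hsub
  rw [h2, Finset.sum_product] at this
  simp only [Finset.sum_const, Int.card_Ico, sub_zero, Int.toNat_natCast, nsmul_eq_mul] at this
  obtain ⟨i, rfl⟩ := ha'
  obtain ⟨j, rfl⟩ := hb'
  rw [modifiedRectangle, Int.modEq_zero_iff_dvd, eq_sub_of_add_eq this]
  exact ⟨j * (∑ y ∈ Finset.Ico (0 : ℤ) ((2 * i + 1 : ℕ) : ℤ), y) - i, by push_cast; ring⟩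

/-- The leftmost column of `M(a, b)` on the diagonal `x + y = k`. -/
def firstColumn (a : ℕ) (k : ℤ) : ℤ :=
  if k < a - 1 then 0 else if k = a - 1 then 1 else k - a + 1

/-- One more than the rightmost column of `M(a, b)` on the diagonal `x + y = k`. -/
def endColumn (b : ℕ) (k : ℤ) : ℤ :=
  if k < b - 1 then k + 1 else if k = b - 1 then b - 1 else b

theorem mem_modifiedRectangle_iff_column {a b : ℕ} {x k : ℤ} :
    (x, k - x) ∈ modifiedRectangle a b ↔ firstColumn a k ≤ x ∧ x < endColumn b k := by
  rw [mem_modifiedRectangle, firstColumn, endColumn]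
  split_ifs <;> omega

/-- The up-steps of the upper left boundary path of `M(a, b)`. -/
noncomputable def upSteps (a : ℕ) : Finset ℤ := insert (a : ℤ) (Finset.Ico 0 ((a : ℤ) - 1))

theorem mem_upSteps {a : ℕ} {x : ℤ} : x ∈ upSteps a ↔ x = a ∨ (0 ≤ x ∧ x < a - 1) := by
  simp [upSteps]

/-- The up-step `x` of `M(a, 4 m + 2)` moves by
`4 * upStepShift m x` between the upper left and the lower right boundary path. -/
def upStepShift (m : ℕ) (x : ℤ) : ℕ := if x % 2 = 0 then m + 1 else m

section

variable {ι : Type*} {P : Finset ι} {s : ι → ℤ} {X : ι → ℤ → ℤ} {a b : ℕ}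

theorem column_sub_first
    (hinj : ∀ k, Set.InjOn (X · k) (P.filter fun p => s p ≤ k ∧ k < s p + 4))
    (hmem : ∀ x y, (x, y) ∈ modifiedRectangle a b ↔
      ∃ p ∈ P, s p ≤ x + y ∧ x + y < s p + 4 ∧ X p (x + y) = x)
    {k z : ℤ} (hz : firstColumn a k ≤ z) (hz' : z ≤ endColumn b k) :
    z - firstColumn a k = ∑ p ∈ P, if s p ≤ k ∧ k < s p + 4 ∧ X p k < z then 1 else 0 := by
  have himg : (P.filter fun p => s p ≤ k ∧ k < s p + 4 ∧ X p k < z).image (X · k) =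
      Finset.Ico (firstColumn a k) z := by
    ext x
    have h1 := mem_modifiedRectangle_iff_column (a := a) (b := b) (x := x) (k := k)
    rw [hmem] at h1
    simp only [Finset.mem_image, Finset.mem_filter, Finset.mem_Ico]
    simp only [add_sub_cancel] at h1
    constructor
    · rintro ⟨p, ⟨hp, h3, h4, h5⟩, rfl⟩
      exact ⟨(h1.1 ⟨p, hp, h3, h4, rfl⟩).1, h5⟩
    · rintro ⟨h3, h4⟩
      obtain ⟨p, hp, h5, h6, h7⟩ := h1.2 ⟨h3, by omega⟩
      exact ⟨p, ⟨hp, h5, h6, by omega⟩, h7⟩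
  have hc := congrArg Finset.card himg
  rw [Finset.card_image_of_injOn, Int.card_Ico] at hc
  · rw [Finset.sum_boole, hc]
    omega
  · refine (hinj k).mono fun p hp => ?_
    simp only [Finset.coe_filter, Set.mem_ofPred_eq] at hp ⊢
    exact ⟨hp.1, hp.2.1, hp.2.2.1⟩

theorem column_bounds
    (hmem : ∀ x y, (x, y) ∈ modifiedRectangle a b ↔
      ∃ p ∈ P, s p ≤ x + y ∧ x + y < s p + 4 ∧ X p (x + y) = x)
    {p : ι} (hp : p ∈ P) {k : ℤ} (h1 : s p ≤ k) (h2 : k < s p + 4) :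
    firstColumn a k ≤ X p k ∧ X p k < endColumn b k := by
  rw [← mem_modifiedRectangle_iff_column, hmem]
  exact ⟨p, hp, by simpa using h1, by simpa using h2, by simp⟩

theorem ribbon_start_nonneg
    (hmem : ∀ x y, (x, y) ∈ modifiedRectangle a b ↔
      ∃ p ∈ P, s p ≤ x + y ∧ x + y < s p + 4 ∧ X p (x + y) = x)
    {p : ι} (hp : p ∈ P) : 0 ≤ s p := by
  have h : (X p (s p), s p - X p (s p)) ∈ modifiedRectangle a b := by
    rw [hmem]
    exact ⟨p, hp, by simp, by simp, by simp⟩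
  rw [mem_modifiedRectangle] at h
  omega

/-- The `max` covers diagonals that miss the region, where the column difference may be negative. -/
theorem card_active
    (hinj : ∀ k, Set.InjOn (X · k) (P.filter fun p => s p ≤ k ∧ k < s p + 4))
    (hmem : ∀ x y, (x, y) ∈ modifiedRectangle a b ↔
      ∃ p ∈ P, s p ≤ x + y ∧ x + y < s p + 4 ∧ X p (x + y) = x) (k : ℤ) :
    (∑ p ∈ P, if s p ≤ k ∧ k < s p + 4 then (1 : ℤ) else 0) =
      max 0 (endColumn b k - firstColumn a k) := by
  by_cases hk : firstColumn a k ≤ endColumn b k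
  · rw [max_eq_right (by omega), column_sub_first hinj hmem hk le_rfl]
    refine Finset.sum_congr rfl fun p hp => ?_
    by_cases h : s p ≤ k ∧ k < s p + 4
    · have := column_bounds hmem hp h.1 h.2
      rw [if_pos h, if_pos ⟨h.1, h.2, this.2⟩]
    · rw [if_neg h, if_neg (fun h' => h ⟨h'.1, h'.2.1⟩)]
  · rw [max_eq_left (by omega)]
    refine Finset.sum_eq_zero fun p hp => if_neg fun h => ?_
    have := column_bounds hmem hp h.1 h.2
    omega

/-- Passing from diagonal `k - 1` to `k`, ribbons starting on `k` enter and those starting on `k -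
4` leave, so the difference is the change of width of the region. -/
theorem ribbon_start_count_sub (ha : 1 < a) (hb : 1 < b)
    (hinj : ∀ k, Set.InjOn (X · k) (P.filter fun p => s p ≤ k ∧ k < s p + 4))
    (hmem : ∀ x y, (x, y) ∈ modifiedRectangle a b ↔
      ∃ p ∈ P, s p ≤ x + y ∧ x + y < s p + 4 ∧ X p (x + y) = x) (k : ℤ) :
    (∑ p ∈ P, if s p = k then (1 : ℤ) else 0) - (∑ p ∈ P, if s p = k - 4 then (1 : ℤ) else 0) =
      (if k ∈ upSteps a then 1 else 0) -
        (if k = b - 1 ∨ (b + 1 ≤ k ∧ k < a + b) then 1 else 0) := by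
  have h1 := card_active hinj hmem k
  have h2 := card_active hinj hmem (k - 1)
  have h3 : (∑ p ∈ P, if s p = k then (1 : ℤ) else 0) -
      (∑ p ∈ P, if s p = k - 4 then (1 : ℤ) else 0) =
      (∑ p ∈ P, if s p ≤ k ∧ k < s p + 4 then (1 : ℤ) else 0) -
      (∑ p ∈ P, if s p ≤ k - 1 ∧ k - 1 < s p + 4 then (1 : ℤ) else 0) := by
    rw [← Finset.sum_sub_distrib, ← Finset.sum_sub_distrib]
    refine Finset.sum_congr rfl fun p _ => ?_
    split_ifs <;> omega
  rw [h3, h1, h2, firstColumn, firstColumn, endColumn, endColumn]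
  simp only [mem_upSteps]
  split_ifs <;> omega

end

theorem sum_upSteps_ite {a : ℕ} (k : ℤ) :
    (∑ x ∈ upSteps a, if x = k then (1 : ℤ) else 0) = if k ∈ upSteps a then 1 else 0 :=
  Finset.sum_ite_eq' _ _ _

/-- Each trajectory telescopes to its two ends. As `a` is odd, even up-steps shift by b + 2 and odd
ones by b - 2 exactly onto the lower right up-steps, where b = 4m + 2. -/
theorem upStep_start_count_sub {a m : ℕ} (ha : Odd a) (k : ℤ) :
    (∑ x ∈ upSteps a, ∑ i ∈ Finset.range (upStepShift m x),
        if x + 4 * i = k then (1 : ℤ) else 0) -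
      (∑ x ∈ upSteps a, ∑ i ∈ Finset.range (upStepShift m x),
        if x + 4 * i = k - 4 then (1 : ℤ) else 0) =
      (if k ∈ upSteps a then 1 else 0) -
        (if k = ((4 * m + 2 : ℕ) : ℤ) - 1 ∨
          (((4 * m + 2 : ℕ) : ℤ) + 1 ≤ k ∧ k < a + (4 * m + 2 : ℕ)) then 1 else 0) := by
  have h1 : ∀ x : ℤ, ∀ e : ℕ, (∑ i ∈ Finset.range e, if x + 4 * i = k then (1 : ℤ) else 0) -
      (∑ i ∈ Finset.range e, if x + 4 * i = k - 4 then (1 : ℤ) else 0) =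
      (if x = k then 1 else 0) - if x + 4 * e = k then 1 else 0 := by
    intro x e
    induction e with
    | zero => simp
    | succ e ih =>
      rw [Finset.sum_range_succ, Finset.sum_range_succ]
      have : (if x + 4 * (e : ℤ) = k - 4 then (1 : ℤ) else 0) =
          if x + 4 * ((e + 1 : ℕ) : ℤ) = k then 1 else 0 := by
        push_cast
        split_ifs <;> omega
      linarith
  -- The shift depends only on parity, which a move by a multiple of 4 preserves.
  have h2 : ∀ x : ℤ, (if x + 4 * (upStepShift m x : ℤ) = k then (1 : ℤ) else 0) =
      if x = k - 4 * upStepShift m k then 1 else 0 := by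
    intro x
    unfold upStepShift
    split_ifs <;> push_cast at * <;> omega
  rw [← Finset.sum_sub_distrib]
  simp only [h1, h2]
  rw [Finset.sum_sub_distrib, sum_upSteps_ite, sum_upSteps_ite]
  simp only [mem_upSteps]
  obtain ⟨i, rfl⟩ := ha
  unfold upStepShift
  congr 1
  split_ifs <;> push_cast at * <;> omega

theorem eq_of_sub_four_eq {n n' : ℤ → ℤ} (h0 : ∀ k < 0, n k = n' k)
    (h : ∀ k, n k - n (k - 4) = n' k - n' (k - 4)) (k : ℤ) : n k = n' k := by
  have key : ∀ N : ℕ, ∀ k : ℤ, k < N → n k = n' k := by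
    intro N
    induction N with
    | zero => exact fun k hk => h0 k (by simpa using hk)
    | succ N ih =>
      intro k hk
      push_cast at hk
      have := ih (k - 4) (by omega)
      have := h k
      omega
  exact key (k.toNat + 1) k (by omega)

/-- Let the up-steps `x` move through `x, x + 4, …`. The number of pairs of moves whose starting
points differ by `2`, plus the number of moves starting `2` before an original up-step, is even. -/
theorem even_upStep_pairs (a m : ℕ) :
    Even (∑ x ∈ upSteps a, ∑ i ∈ Finset.range (upStepShift m x),
      ((if x + 4 * i + 2 ∈ upSteps a then (1 : ℤ) else 0) +
        ∑ y ∈ upSteps a, ∑ j ∈ Finset.range (upStepShift m y),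
          if y + 4 * j = x + 4 * i + 2 then 1 else 0)) := by
  have h : ∀ x ∈ upSteps a, ∑ i ∈ Finset.range (upStepShift m x),
      ((if x + 4 * i + 2 ∈ upSteps a then (1 : ℤ) else 0) +
        ∑ y ∈ upSteps a, ∑ j ∈ Finset.range (upStepShift m y),
          if y + 4 * j = x + 4 * i + 2 then 1 else 0) =
      ∑ y ∈ upSteps a, if x % 2 = y % 2 then stepPairs (upStepShift m x) x y else 0 := by
    intro x _
    simp only [← sum_upSteps_ite, ← Finset.sum_add_distrib]
    rw [Finset.sum_comm]
    refine Finset.sum_congr rfl fun y _ => ?_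
    split_ifs with hxy
    -- Equal parity means equally many moves, as `stepPairs` requires.
    · have : upStepShift m y = upStepShift m x := by simp only [upStepShift, hxy]
      rw [this, stepPairs]
    · refine Finset.sum_eq_zero fun i _ => ?_
      rw [if_neg (by omega), Finset.sum_eq_zero fun j _ => if_neg (by omega), add_zero]
  rw [Finset.sum_congr rfl h]
  refine even_sum_of_even_add_swap _ _ (fun x y => ?_) fun x => by simp [stepPairs_self]
  by_cases hxy : x % 2 = y % 2
  · have : upStepShift m y = upStepShift m x := by simp only [upStepShift, hxy]
    rw [if_pos hxy, if_pos hxy.symm, this]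
    exact even_stepPairs_add_swap _ _ _
  · rw [if_neg hxy, if_neg (Ne.symm hxy)]
    simp

theorem firstColumn_sub {a : ℕ} {k : ℤ} (hk : 0 ≤ k) :
    firstColumn a k - firstColumn a (k - 1) = 1 - if k ∈ upSteps a then 1 else 0 := by
  simp only [firstColumn, mem_upSteps]
  split_ifs <;> omega

/-! ### Necessity -/

theorem eight_dvd_card {a m : ℕ} (ha : 1 < a) (ha' : Odd a)
    (h : TilesRegion tileSetS (modifiedRectangle a (4 * m + 2))) :
    8 ∣ (modifiedRectangle a (4 * m + 2)).card := by
  have hb : 1 < 4 * m + 2 := by omega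
  obtain ⟨P, s, X, hX, hinj, hmem, hcard, hsum⟩ := h.exists_ribbons
  have hpar := ribbon_parity P s X (firstColumn a) hX hinj fun q hq k h1 h2 =>
    have hq' := column_bounds hmem hq h1 h2
    column_sub_first hinj hmem hq'.1 hq'.2.le
  have hcount : ∀ F : ℤ → ℤ, ∑ p ∈ P, F (s p) =
      ∑ x ∈ upSteps a, ∑ i ∈ Finset.range (upStepShift m x), F (x + 4 * i) := by
    intro F
    rw [Finset.sum_sigma' (upSteps a) (fun x => Finset.range (upStepShift m x))
      fun x i => F (x + 4 * i)]
    refine sum_comp_eq_of_card_fiber_eq P _ s (fun j : Σ _ : ℤ, ℕ => j.1 + 4 * j.2)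
      (fun k => ?_) F
    have key := eq_of_sub_four_eq
      (n := fun k => ∑ p ∈ P, if s p = k then (1 : ℤ) else 0)
      (n' := fun k => ∑ x ∈ upSteps a, ∑ i ∈ Finset.range (upStepShift m x),
        if x + 4 * i = k then (1 : ℤ) else 0) ?_ ?_ k
    · rw [Finset.sum_sigma' (upSteps a) (fun x => Finset.range (upStepShift m x))
        fun x i => if x + 4 * (i : ℤ) = k then (1 : ℤ) else 0] at key
      simp only [Finset.sum_boole] at key
      exact_mod_cast key
    · intro k hk
      rw [Finset.sum_eq_zero, Finset.sum_eq_zero]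
      · intro x hx
        refine Finset.sum_eq_zero fun i _ => if_neg ?_
        rw [mem_upSteps] at hx
        omega
      · intro p hp
        have := ribbon_start_nonneg hmem hp
        exact if_neg (by omega)
    · intro k
      rw [ribbon_start_count_sub ha hb hinj hmem, upStep_start_count_sub ha']
  have hf : ∑ q ∈ P, (firstColumn a (s q + 2) - firstColumn a (s q + 1)) =
      P.card - ∑ q ∈ P, if s q + 2 ∈ upSteps a then 1 else 0 := by
    rw [Finset.card_eq_sum_ones, Nat.cast_sum, ← Finset.sum_sub_distrib]
    refine Finset.sum_congr rfl fun q hq => ?_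
    have := ribbon_start_nonneg hmem hq
    have := firstColumn_sub (a := a) (k := s q + 2) (by omega)
    rw [show s q + 2 - 1 = s q + 1 by ring] at this
    simpa using this
  have heven := even_upStep_pairs a m
  have hpairs : ∑ q ∈ P, ((if s q + 2 ∈ upSteps a then (1 : ℤ) else 0) +
      ∑ p ∈ P, if s p = s q + 2 then 1 else 0) = _ :=
    (hcount fun z => (if z + 2 ∈ upSteps a then (1 : ℤ) else 0) +
      ∑ p ∈ P, if s p = z + 2 then 1 else 0).trans
    (Finset.sum_congr rfl fun x _ => Finset.sum_congr rfl fun i _ => by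
      rw [hcount fun w => if w = x + 4 * i + 2 then 1 else 0])
  rw [← hpairs, Finset.sum_add_distrib] at heven
  rw [hf] at hpar
  have hrows := even_sum_snd_modifiedRectangle ha hb ha' ⟨2 * m + 1, by ring⟩
  -- Modulo 2 this reads 0 = number of tiles + the even count in `heven`.
  have h3 := (hrows.symm.trans hsum).trans hpar
  rw [Int.ModEq] at h3
  rw [Int.even_iff] at heven
  rw [hcard]
  omega

theorem mainTheorem4 (a b : ℕ) (ha : 1 < a) (hb : 1 < b) :
    TilesRegion tileSetS (modifiedRectangle a b) ↔
      (a ≡ 2 [MOD 4] ∧ Odd b) ∨ (Odd a ∧ a * b ≡ 2 [MOD 8]) := by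
  refine ⟨fun h => ?_, tiles_of_congruence ha hb⟩
  have hcard := card_modifiedRectangle ha hb
  have h4 : a * b % 4 = 2 := by
    obtain ⟨P, s, X, -, -, -, h1, -⟩ := h.exists_ribbons
    omega
  have h4' : (a % 4 = 2 ∧ b % 2 = 1) ∨ (a % 2 = 1 ∧ b % 4 = 2) := by
    rw [Nat.mul_mod] at h4
    have h5 : a % 4 < 4 := Nat.mod_lt _ (by norm_num)
    have h6 : b % 4 < 4 := Nat.mod_lt _ (by norm_num)
    have h7 : a % 2 = a % 4 % 2 := by omega
    have h8 : b % 2 = b % 4 % 2 := by omega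
    rw [h7, h8]
    generalize a % 4 = r at *
    generalize b % 4 = t at *
    interval_cases r <;> interval_cases t <;> simp_all
  rcases h4' with ⟨h5, h6⟩ | ⟨h5, h6⟩
  · exact Or.inl ⟨h5, Nat.odd_iff.2 h6⟩
  · obtain ⟨m, rfl⟩ : ∃ m, b = 4 * m + 2 := ⟨b / 4, by omega⟩
    have h7 := eight_dvd_card ha (Nat.odd_iff.2 h5) h
    refine Or.inr ⟨Nat.odd_iff.2 h5, ?_⟩
    rw [Nat.ModEq]
    omega
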